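/- Conventions. A kernel on a set $X$ is a positive semi-definite function $k:X\times X\to\mathbb{C}$; $\mathcal{H}_k$ is its reproducing kernel Hilbert space, with kernel functions $k_w(z)=k(z,w)$. A kernel $s$ is a normalized complete Pick kernel if $s(z,w)=\frac{1}{1-\langle b(z),b(w)\rangle}$ for some map $b$ from $X$ into the open unit ball of a Hilbert space with $b(w_0)=0$ for some $w_0\in X$; it is a normalized complete Pick factor of $\ell$ if moreover $\ell=s\cdot g$ for some kernel $g$ on $X$. A sequence $\{\lambda_i\}\subset X$ - satisfies the Carleson measure condition for $\mathcal{H}_k$ if there is $C>0$ with $\sum_i |f(\lambda_i)|^2/\|k_{\lambda_i}\|^2\le C\|f\|^2_{\mathcal{H}_k}$ for all $f\in\mathcal{H}_k$; - is weakly separated by $k$ if there is $\epsilon>0$ with $\sqrt{1-\frac{|\langle k_{\lambda_i},k_{\lambda_j}\rangle|^2}{\|k_{\lambda_i}\|^2\|k_{\lambda_j}\|^2}}\ge\epsilon$ for all $i\ne j$; - is $n$-weakly separated by $k$ if there is $\epsilon>0$ such that $\mathrm{dist}\Big(\frac{k_{\mu_1}}{\|k_{\mu_1}\|},\mathrm{span}\Big\{\frac{k_{\mu_2}}{\|k_{\mu_2}\|},\dots,\frac{k_{\mu_n}}{\|k_{\mu_n}\|}\Big\}\Big)\ge\epsilon$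 for every $n$-point subset $\{\mu_1,\dots,\mu_n\}\subset\{\lambda_i\}$ (and every choice of its first point $\mu_1$); - is $\mathrm{Mult}(\mathcal{H}_k,\mathcal{H}_\ell)$-interpolating if for every bounded sequence $\{w_i\}\subset\mathbb{C}$ there is a function $\phi$ that multiplies $\mathcal{H}_k$ boundedly into $\mathcal{H}_\ell$ with $\phi(\lambda_i)=w_i\|\ell_{\lambda_i}\|/\|k_{\lambda_i}\|$ for all $i$. Theorem. Let $s(z,w)=\frac{1}{1-z\overline{w}}$ be the Szegő kernel on the unit disk $\mathbb{D}$. There exists a kernel $\ell$ on $\mathbb{D}$ with $\ell_z\neq 0$ for all $z\in\mathbb{D}$, having $s$ as a normalized complete Pick factor, with the following property: for every $n\ge 2$ there exists a sequence $\{\lambda_i\}_{i\in\mathbb{N}}$ of distinct points of $\mathbb{D}$ that satisfies the Carleson measure condition for $\mathcal{H}_s$ and is $n$-weakly separated, but not $(n+1)$-weakly separated, by $\ell$; and such that, moreover, $\{\lambda_i\}$ is not $\mathrm{Mult}(\mathcal{H}_s,\mathcal{H}_\ell)$-interpolating. Consequently, for this pair $(s,\ell)$ it is not true that a sequence of distinct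 points of $\mathbb{D}$ is $\mathrm{Mult}(\mathcal{H}_s,\mathcal{H}_\ell)$-interpolating if and only if it satisfies the Carleson measure condition for $\mathcal{H}_s$ and is weakly separated by $\ell$ (which answers negatively the question of Aleman, Hartz, McCarthy and Richter). -/

import Mathlib

open scoped ComplexConjugate ComplexOrder Complex.UnitDisc

noncomputable section

universe u

/-- A (scalar, complex-valued) reproducing kernel on `X`: a positive semi-definite function
`k : X × X → ℂ`, that is, all finite matrices `[k (x i) (x j)]` are positive semi-definite. -/
structure ReproducingKernel (X : Type u) where
  /-- The values `k z w = k_w(z)`. -/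
  toFun : X → X → ℂ
  posSemidef : (Matrix.of toFun).PosSemidef

namespace ReproducingKernel

variable {X : Type u}

instance : CoeFun (ReproducingKernel X) fun _ => X → X → ℂ := ⟨toFun⟩

/-- The scalar kernel as an operator-valued kernel on the one-dimensional space `ℂ`, the form
in which Mathlib takes kernels. -/
def opKernel (k : ReproducingKernel X) : Matrix X X (ℂ →L[ℂ] ℂ) :=
  Matrix.of fun z w => k z w • (1 : ℂ →L[ℂ] ℂ)

theorem opKernel_posSemidef (k : ReproducingKernel X) : k.opKernel.PosSemidef := by
  have hs : ∀ x y, star (k y x) = k x y := fun x y => k.posSemidef.isHermitian.apply x y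
  have hH : k.opKernel.IsHermitian := by
    refine Matrix.IsHermitian.ext fun z w => ?_
    simp only [opKernel, Matrix.of_apply, star_smul, star_one, hs]
  have key := RKHS.posSemidef_tfae (K := k.opKernel)
  have key2 := key.out 0 2
  refine key2.mpr ⟨hH, fun v => ?_⟩
  have h := k.posSemidef.2 v
  rw [Finsupp.sum_comm] at h
  have h2 := (Complex.le_def.mp h).1
  have e : (v.sum fun x w => v.sum fun x' w' => inner ℂ (k.opKernel x' x w) w') =
      star (v.sum fun j xj => v.sum fun i xi => star xi * Matrix.of k.toFun i j * xj) := by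
    simp only [Finsupp.sum, star_sum]
    refine Finset.sum_congr rfl fun x _ => Finset.sum_congr rfl fun y _ => ?_
    simp [opKernel]
    ring
  rw [e]
  change 0 ≤ (star _ : ℂ).re
  rw [Complex.star_def, Complex.conj_re]
  exact h2

instance (k : ReproducingKernel X) : Fact k.opKernel.PosSemidef := ⟨k.opKernel_posSemidef⟩

/-- The reproducing kernel Hilbert space `H_k`; its elements act as functions `X → ℂ`. -/
abbrev space (k : ReproducingKernel X) : Type u := RKHS.OfKernel k.opKernel

/-- The kernel function `k_w ∈ H_k`, characterized by `⟨f, k_w⟩ = f(w)`. -/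
def kerVec (k : ReproducingKernel X) (w : X) : k.space := RKHS.kerFun k.space w (1 : ℂ)

/-- Sanity check: the kernel function `k_w`, as a function on `X`, is `z ↦ k z w`. -/
theorem kerVec_apply (k : ReproducingKernel X) (w z : X) : k.kerVec w z = k z w := by
  rw [kerVec, RKHS.kerFun_apply, RKHS.OfKernel.kernel_ofKernel]
  simp [opKernel]

/-- The normalized kernel function `k_w / ‖k_w‖`. -/
def normVec (k : ReproducingKernel X) (w : X) : k.space :=
  ((‖k.kerVec w‖ : ℂ)⁻¹) • k.kerVec w

/-- The pseudometric `d_k(z, w) = √(1 - |⟨k_z, k_w⟩|² / (‖k_z‖² ‖k_w‖²))`. -/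
def kerDist (k : ReproducingKernel X) (z w : X) : ℝ :=
  √(1 - ‖inner ℂ (k.kerVec z) (k.kerVec w)‖ ^ 2 / (‖k.kerVec z‖ ^ 2 * ‖k.kerVec w‖ ^ 2))

/-- Weak separation of a sequence by `k`. -/
def WeaklySeparated (k : ReproducingKernel X) (p : ℕ → X) : Prop :=
  ∃ ε > 0, ∀ i j, i ≠ j → ε ≤ k.kerDist (p i) (p j)

/-- `n`-weak separation by `k`: for some `ε > 0`, for every `n`-point subset of the sequence, the
normalized kernel function at any one of its points has distance at least `ε` from the span of
the normalized kernel functions at the other points. -/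
def NWeaklySeparated (k : ReproducingKernel X) (n : ℕ) (p : ℕ → X) : Prop :=
  ∃ ε > 0, ∀ S : Finset X, S.card = n → (S : Set X) ⊆ Set.range p → ∀ x ∈ S,
    ε ≤ Metric.infDist (k.normVec x)
      (Submodule.span ℂ (k.normVec '' ((S : Set X) \ {x})) : Set k.space)

/-- The Carleson measure condition for `H_k`: there is `C > 0` with
`∑ |f(p i)|² / ‖k_{p i}‖² ≤ C ‖f‖²` for all `f ∈ H_k`. -/
def CarlesonCondition (k : ReproducingKernel X) (p : ℕ → X) : Prop :=
  ∃ C > 0, ∀ f : k.space, Summable (fun i => ‖f (p i)‖ ^ 2 / ‖k.kerVec (p i)‖ ^ 2) ∧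
    ∑' i, ‖f (p i)‖ ^ 2 / ‖k.kerVec (p i)‖ ^ 2 ≤ C * ‖f‖ ^ 2

/-- `φ ∈ Mult(H_k, H_l)`: multiplication by `φ` is a bounded operator from `H_k` to `H_l`. -/
def IsMultiplier (k l : ReproducingKernel X) (φ : X → ℂ) : Prop :=
  ∃ M : k.space →L[ℂ] l.space, ∀ (f : k.space) (z : X), M f z = φ z * f z

/-- Interpolating sequences for `Mult(H_k, H_l)`: for every bounded `w` some multiplier `φ`
satisfies `φ(p i) = w i ‖l_{p i}‖ / ‖k_{p i}‖` for all `i`. -/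
def IsInterpolating (k l : ReproducingKernel X) (p : ℕ → X) : Prop :=
  ∀ w : ℕ → ℂ, (∃ B : ℝ, ∀ i, ‖w i‖ ≤ B) →
    ∃ φ : X → ℂ, IsMultiplier k l φ ∧
      ∀ i, φ (p i) = w i * ((‖l.kerVec (p i)‖ / ‖k.kerVec (p i)‖ : ℝ) : ℂ)

/-- A normalized complete Pick kernel: `s z w = 1 / (1 - ⟨b z, b w⟩)` for a map `b` from `X` into
the open unit ball of a Hilbert space, vanishing at some point (the inner product being linear in
the first variable on paper, in the second one in Mathlib). -/
def IsNormalizedCompletePick (s : ReproducingKernel X) : Prop :=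
  ∃ (K : Type u) (_ : NormedAddCommGroup K) (_ : InnerProductSpace ℂ K) (_ : CompleteSpace K)
    (b : X → K), (∀ z, ‖b z‖ < 1) ∧ (∃ w₀, b w₀ = 0) ∧
      ∀ z w, s z w = 1 / (1 - inner ℂ (b w) (b z))

/-- `s` is a normalized complete Pick factor of `l`: it is a normalized complete Pick kernel and
`l = s · g` for some (positive semi-definite) kernel `g`. -/
def IsNormalizedCompletePickFactor (s l : ReproducingKernel X) : Prop :=
  s.IsNormalizedCompletePick ∧ ∃ g : ReproducingKernel X, ∀ z w, l z w = s z w * g z w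

end ReproducingKernel

end

/-!
The kernel `l` is a product `s * g` with a kernel `g` that has nothing to do with the complex
structure of the disc. Disjoint finite sets of points ("clusters") are fixed in the disc, infinitely
many with `n + 1` points for each `n`; on a cluster of `n + 1` points `g` is the Gram matrix of the
unit vectors from the centre to the vertices of a regular simplex (`1` on the diagonal, `-1 / n` off
it), and points not in a common cluster are orthogonal (`simplexGram`). Everything follows from the
size of the off-diagonal entries:

* `g` and `s * g` are diagonally dominant after normalization, hence positive semi-definite
  (`posSemidef_of_diagDominant`), and among any `n` points of clusters of `n + 1` points the
  off-diagonal row sums are at most `(n - 1) / n`, which gives `n`-weak separation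
  (`ReproducingKernel.nWeaklySeparated_mulSimplex`). No information on `s` is needed here.
* The points of the `j`-th cluster of type `n` coalesce hyperbolically as `j` grows, so that the
  normalized Gram matrix of `s * g` there tends to the singular Gram matrix of the simplex, and the
  sum of the normalized kernel functions over the cluster tends to zero
  (`exists_norm_sum_cluster_lt`). This contradicts `(n + 1)`-weak separation. It also contradicts
  the boundedness of the adjoint of a multiplier `φ` that takes the value `1` at one point of each
  cluster and `0` at the others, as this adjoint maps `l_z` to `conj (φ z) • s_z`
  (`not_isInterpolating_clusterSeq`).
* Different clusters approach the unit circle at very different rates, so the Gram matrix of the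
  normalized Szegő kernel functions has bounded row sums, and the Schur test gives the Carleson
  measure condition (`szegoKernel_carlesonCondition_clusterSeq`).
-/

open scoped ComplexConjugate ComplexOrder Complex.UnitDisc

/-! ### The Schur test and diagonal dominance -/

/-- The Schur test for a symmetric matrix with nonnegative entries, as a bound on its quadratic
form. -/
theorem sum_mul_mul_le_of_rowSum_le {ι : Type*} (F : Finset ι) (A : ι → ι → ℝ)
    (hA : ∀ i j, 0 ≤ A i j) (hsymm : ∀ i j, A i j = A j i) (ρ : ℝ)
    (hρ : ∀ i ∈ F, ∑ j ∈ F, A i j ≤ ρ) (x : ι → ℝ) :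
    ∑ i ∈ F, ∑ j ∈ F, A i j * (x i * x j) ≤ ρ * ∑ i ∈ F, x i ^ 2 := by
  have h1 : ∑ i ∈ F, ∑ j ∈ F, A i j * (x i * x j) ≤
      ∑ i ∈ F, ∑ j ∈ F, (A i j * x i ^ 2 / 2 + A i j * x j ^ 2 / 2) := by
    refine Finset.sum_le_sum fun i _ => Finset.sum_le_sum fun j _ => ?_
    nlinarith [mul_nonneg (hA i j) (sq_nonneg (x i - x j))]
  have h2 : ∑ i ∈ F, ∑ j ∈ F, A i j * x i ^ 2 / 2 ≤ ρ * (∑ i ∈ F, x i ^ 2) / 2 := by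
    rw [Finset.mul_sum, Finset.sum_div]
    refine Finset.sum_le_sum fun i hi => ?_
    rw [← Finset.sum_div, ← Finset.sum_mul]
    gcongr
    exact hρ i hi
  have h3 : ∑ i ∈ F, ∑ j ∈ F, A i j * x j ^ 2 / 2 = ∑ i ∈ F, ∑ j ∈ F, A i j * x i ^ 2 / 2 := by
    rw [Finset.sum_comm]
    exact Finset.sum_congr rfl fun i _ => Finset.sum_congr rfl fun j _ => by rw [hsymm]
  simp only [Finset.sum_add_distrib] at h1
  linarith

/-- A quadratic form with diagonal `d z ^ 2` whose off-diagonal entries are at most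
`r z w * (d z * d w)`, where the off-diagonal row sums of `r` are at most `ρ`, is bounded below by
`1 - ρ` times its diagonal part. -/
theorem one_sub_mul_le_re_sum {X : Type*} [DecidableEq X] (F : Finset X) (h : X → X → ℂ)
    (d : X → ℝ) (r : X → X → ℝ) (hr : ∀ z w, 0 ≤ r z w) (hrs : ∀ z w, r z w = r w z)
    (hdiag : ∀ z, h z z = ((d z ^ 2 : ℝ) : ℂ))
    (hoff : ∀ z w, z ≠ w → ‖h z w‖ ≤ r z w * (d z * d w)) (ρ : ℝ)
    (hρ : ∀ z ∈ F, ∑ w ∈ F.erase z, r z w ≤ ρ) (c : X → ℂ) :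
    (1 - ρ) * ∑ z ∈ F, (‖c z‖ * d z) ^ 2 ≤
      (∑ z ∈ F, ∑ w ∈ F, star (c z) * h z w * c w).re := by
  have hS := sum_mul_mul_le_of_rowSum_le F (fun z w => if z = w then 0 else r z w)
    (fun z w => by split_ifs <;> simp [hr]) (fun z w => by
      simp only [eq_comm (a := z), hrs z w]) ρ (fun z hz => by
        refine le_trans (le_of_eq ?_) (hρ z hz)
        rw [← Finset.add_sum_erase _ _ hz, if_pos rfl, zero_add]
        exact Finset.sum_congr rfl fun w hw => if_neg (Finset.ne_of_mem_erase hw).symm)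
    (fun z => ‖c z‖ * d z)
  have key : ∑ z ∈ F, (‖c z‖ * d z) ^ 2 - ∑ z ∈ F, ∑ w ∈ F,
      (if z = w then 0 else r z w) * ((‖c z‖ * d z) * (‖c w‖ * d w)) ≤
      (∑ z ∈ F, ∑ w ∈ F, star (c z) * h z w * c w).re := by
    rw [← Finset.sum_sub_distrib, Complex.re_sum]
    refine Finset.sum_le_sum fun z hz => ?_
    rw [← Finset.add_sum_erase _ _ hz, ← Finset.add_sum_erase _ _ hz, if_pos rfl, zero_mul,
      zero_add, Complex.add_re, Complex.re_sum, sub_eq_add_neg, ← Finset.sum_neg_distrib]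
    refine add_le_add (le_of_eq ?_) (Finset.sum_le_sum fun w hw => ?_)
    · have : star (c z) * h z z * c z = ((‖c z‖ ^ 2 * d z ^ 2 : ℝ) : ℂ) := by
        rw [hdiag, mul_right_comm, Complex.star_def, mul_comm (conj (c z)), Complex.mul_conj']
        push_cast
        ring
      rw [this, Complex.ofReal_re, mul_pow]
    · have hne := (Finset.ne_of_mem_erase hw).symm
      rw [if_neg hne]
      refine neg_le_of_abs_le (le_trans (Complex.abs_re_le_norm _) ?_)
      rw [norm_mul, norm_mul, norm_star]
      nlinarith [mul_le_mul_of_nonneg_left (hoff z w hne)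
        (mul_nonneg (norm_nonneg (c z)) (norm_nonneg (c w)))]
  nlinarith

/-- A Hermitian kernel that is diagonally dominant (after scaling by `d`) is positive
semi-definite. -/
theorem posSemidef_of_diagDominant {X : Type*} [DecidableEq X] (h : X → X → ℂ)
    (hherm : ∀ z w, star (h w z) = h z w)
    (d : X → ℝ) (r : X → X → ℝ) (hr : ∀ z w, 0 ≤ r z w) (hrs : ∀ z w, r z w = r w z)
    (hdiag : ∀ z, h z z = ((d z ^ 2 : ℝ) : ℂ))
    (hoff : ∀ z w, z ≠ w → ‖h z w‖ ≤ r z w * (d z * d w))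
    (hρ : ∀ (F : Finset X), ∀ z ∈ F, ∑ w ∈ F.erase z, r z w ≤ 1) :
    (Matrix.of h).PosSemidef := by
  refine ⟨Matrix.IsHermitian.ext hherm, fun x => ?_⟩
  have h1 := one_sub_mul_le_re_sum x.support h d r hr hrs hdiag hoff 1 (hρ x.support) x
  rw [sub_self, zero_mul] at h1
  change 0 ≤ ∑ z ∈ x.support, ∑ w ∈ x.support, star (x z) * h z w * x w
  refine Complex.le_def.2 ⟨h1, ?_⟩
  refine (Complex.conj_eq_iff_im.1 ?_).symm
  rw [map_sum, Finset.sum_congr rfl fun _ _ => map_sum _ _ _, Finset.sum_comm]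
  refine Finset.sum_congr rfl fun z _ => Finset.sum_congr rfl fun w _ => ?_
  rw [← hherm z w]
  simp only [Complex.star_def, map_mul, Complex.conj_conj]
  ring

/-- Vectors whose Gram matrix has absolute row sums at most `ρ` satisfy Bessel's inequality with
the constant `ρ`. -/
theorem sum_norm_inner_sq_le_of_rowSum_le {E ι : Type*} [NormedAddCommGroup E]
    [InnerProductSpace ℂ E] (F : Finset ι) (v : ι → E) {ρ : ℝ}
    (hρ0 : 0 ≤ ρ) (hρ : ∀ i ∈ F, ∑ j ∈ F, ‖inner ℂ (v i) (v j)‖ ≤ ρ) (f : E) :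
    ∑ i ∈ F, ‖inner ℂ (v i) f‖ ^ 2 ≤ ρ * ‖f‖ ^ 2 := by
  set T := ∑ i ∈ F, ‖inner ℂ (v i) f‖ ^ 2 with hT
  set x : E := ∑ i ∈ F, inner ℂ (v i) f • v i with hx
  have hT0 : 0 ≤ T := Finset.sum_nonneg fun i _ => sq_nonneg _
  have h1 : (T : ℂ) = inner ℂ x f := by
    rw [hx, sum_inner, hT]
    push_cast
    refine Finset.sum_congr rfl fun i _ => ?_
    rw [inner_smul_left, mul_comm, Complex.mul_conj']
  have h2 : ‖x‖ ^ 2 ≤ ρ * T := by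
    have h3 : ((‖x‖ ^ 2 : ℝ) : ℂ) = ∑ i ∈ F, ∑ j ∈ F,
        conj (inner ℂ (v i) f) * inner ℂ (v j) f * inner ℂ (v i) (v j) := by
      have : ((‖x‖ ^ 2 : ℝ) : ℂ) = inner ℂ x x := by
        rw [inner_self_eq_norm_sq_to_K]; push_cast; rfl
      rw [this, hx, sum_inner]
      refine Finset.sum_congr rfl fun i _ => ?_
      rw [inner_sum]
      refine Finset.sum_congr rfl fun j _ => ?_
      rw [inner_smul_left, inner_smul_right]
      ring
    have h4 : ‖x‖ ^ 2 = ‖((‖x‖ ^ 2 : ℝ) : ℂ)‖ := by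
      rw [Complex.norm_real, Real.norm_of_nonneg (sq_nonneg _)]
    rw [h4, h3]
    refine le_trans (norm_sum_le _ _) (le_trans (Finset.sum_le_sum fun i _ => norm_sum_le _ _) ?_)
    refine le_trans (le_of_eq ?_) (sum_mul_mul_le_of_rowSum_le F
      (fun i j => ‖inner ℂ (v i) (v j)‖) (fun _ _ => norm_nonneg _)
      (fun _ _ => norm_inner_symm _ _) ρ hρ (fun i => ‖inner ℂ (v i) f‖))
    refine Finset.sum_congr rfl fun i _ => Finset.sum_congr rfl fun j _ => ?_
    rw [norm_mul, norm_mul, RCLike.norm_conj]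
    ring
  have h5 : T ≤ ‖x‖ * ‖f‖ := by
    calc T = ‖(T : ℂ)‖ := by rw [Complex.norm_real, Real.norm_of_nonneg hT0]
      _ ≤ _ := by rw [h1]; exact norm_inner_le_norm _ _
  have h6 : T * T ≤ T * (ρ * ‖f‖ ^ 2) := by
    calc T * T ≤ (‖x‖ * ‖f‖) * (‖x‖ * ‖f‖) := mul_self_le_mul_self hT0 h5
      _ = ‖x‖ ^ 2 * ‖f‖ ^ 2 := by ring
      _ ≤ ρ * T * ‖f‖ ^ 2 := by gcongr
      _ = _ := by ring
  rcases hT0.eq_or_lt with h0 | h0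
  · rw [← h0]
    positivity
  · exact le_of_mul_le_mul_left h6 h0

namespace ReproducingKernel

variable {X : Type*} (k : ReproducingKernel X)

/-! ### Kernel functions and their Gram matrices -/

theorem inner_kerVec_left (z : X) (f : k.space) : inner ℂ (k.kerVec z) f = f z := by
  rw [kerVec, RKHS.kerFun_inner]
  simp

theorem inner_kerVec_kerVec (z w : X) : inner ℂ (k.kerVec z) (k.kerVec w) = k z w := by
  rw [inner_kerVec_left, kerVec_apply]

theorem star_apply (z w : X) : star (k w z) = k z w := k.posSemidef.isHermitian.apply z w

theorem apply_self (z : X) : k z z = ((‖k.kerVec z‖ ^ 2 : ℝ) : ℂ) := by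
  rw [← inner_kerVec_kerVec, inner_self_eq_norm_sq_to_K]
  push_cast
  rfl

theorem norm_apply_le (z w : X) : ‖k z w‖ ≤ ‖k.kerVec z‖ * ‖k.kerVec w‖ := by
  rw [← inner_kerVec_kerVec]
  exact norm_inner_le_norm _ _

theorem inner_normVec_left (z : X) (f : k.space) :
    inner ℂ (k.normVec z) f = f z / (‖k.kerVec z‖ : ℂ) := by
  rw [normVec, inner_smul_left, inner_kerVec_left, map_inv₀, Complex.conj_ofReal]
  ring

theorem inner_normVec_normVec (z w : X) :
    inner ℂ (k.normVec z) (k.normVec w) =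
      k z w / ((‖k.kerVec z‖ * ‖k.kerVec w‖ : ℝ) : ℂ) := by
  rw [normVec, normVec, inner_smul_left, inner_smul_right, inner_kerVec_kerVec, map_inv₀,
    Complex.conj_ofReal]
  push_cast
  ring

theorem norm_normVec {z : X} (hz : k.kerVec z ≠ 0) : ‖k.normVec z‖ = 1 := by
  rw [normVec, norm_smul, norm_inv, Complex.norm_real, norm_norm,
    inv_mul_cancel₀ (norm_ne_zero_iff.2 hz)]

theorem normSq_sum_smul_normVec (F : Finset X) (c : X → ℂ) :
    ‖∑ z ∈ F, c z • k.normVec z‖ ^ 2 =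
      (∑ z ∈ F, ∑ w ∈ F, star (c z) * inner ℂ (k.normVec z) (k.normVec w) * c w).re := by
  have : ((‖∑ z ∈ F, c z • k.normVec z‖ ^ 2 : ℝ) : ℂ) =
      ∑ z ∈ F, ∑ w ∈ F, star (c z) * inner ℂ (k.normVec z) (k.normVec w) * c w := by
    have h : ((‖∑ z ∈ F, c z • k.normVec z‖ ^ 2 : ℝ) : ℂ) =
        inner ℂ (∑ z ∈ F, c z • k.normVec z) (∑ z ∈ F, c z • k.normVec z) := by
      rw [inner_self_eq_norm_sq_to_K]; push_cast; rfl
    rw [h, sum_inner]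
    refine Finset.sum_congr rfl fun i _ => ?_
    rw [inner_sum]
    refine Finset.sum_congr rfl fun j _ => ?_
    rw [inner_smul_left, inner_smul_right, Complex.star_def]
    ring
  rw [← this, Complex.ofReal_re]

theorem CarlesonCondition.of_rowSum_le {ι : Type*} (e : ℕ ≃ ι) (p : ι → X) {ρ : ℝ} (hρ0 : 0 < ρ)
    (hρ : ∀ (F : Finset ι), ∀ i ∈ F,
      ∑ j ∈ F, ‖inner ℂ (k.normVec (p i)) (k.normVec (p j))‖ ≤ ρ) :
    k.CarlesonCondition (p ∘ e) := by
  have key : ∀ (f : k.space) (F : Finset ℕ),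
      ∑ i ∈ F, ‖f ((p ∘ e) i)‖ ^ 2 / ‖k.kerVec ((p ∘ e) i)‖ ^ 2 ≤ ρ * ‖f‖ ^ 2 := by
    intro f F
    refine le_trans (le_of_eq ?_) (sum_norm_inner_sq_le_of_rowSum_le (F.map e.toEmbedding)
      (fun i => k.normVec (p i)) hρ0.le (hρ _) f)
    rw [Finset.sum_map]
    refine Finset.sum_congr rfl fun i _ => ?_
    rw [inner_normVec_left, norm_div, Complex.norm_real, norm_norm, div_pow]
    rfl
  have hn : ∀ (f : k.space) i, 0 ≤ ‖f ((p ∘ e) i)‖ ^ 2 / ‖k.kerVec ((p ∘ e) i)‖ ^ 2 :=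
    fun f i => by positivity
  exact ⟨ρ, hρ0, fun f => ⟨summable_of_sum_le (hn f) (key f),
    Real.tsum_le_of_sum_le (hn f) (key f)⟩⟩

/-- For sequences of distinct points, `2`-weak separation implies weak separation: the distance
from `k_z / ‖k_z‖` to the line through `k_w` is `d_k(z, w)`. -/
theorem NWeaklySeparated.weaklySeparated {p : ℕ → X} (hp : Function.Injective p)
    (hk : ∀ z, k.kerVec z ≠ 0) (h : k.NWeaklySeparated 2 p) : k.WeaklySeparated p := by
  classical
  obtain ⟨ε, hε, H⟩ := h
  refine ⟨ε, hε, fun i j hij => ?_⟩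
  have hne : p i ≠ p j := hp.ne hij
  have h1 := H {p i, p j} (Finset.card_pair hne)
    (by rw [Finset.coe_pair]; rintro _ (rfl | rfl) <;> exact Set.mem_range_self _) (p i) (by simp)
  refine h1.trans ?_
  set a := k.normVec (p i)
  set b := k.normVec (p j)
  have hb : inner ℂ b a • b ∈
      Submodule.span ℂ (k.normVec '' (((({p i, p j} : Finset X)) : Set X) \ {p i})) :=
    Submodule.smul_mem _ _ (Submodule.subset_span ⟨p j, by simp [hne.symm], rfl⟩)
  refine (Metric.infDist_le_dist_of_mem hb).trans ?_
  rw [kerDist, dist_eq_norm]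
  refine Real.le_sqrt_of_sq_le (le_of_eq ?_)
  have hA : ‖a‖ = 1 := k.norm_normVec (hk _)
  have hB : ‖b‖ = 1 := k.norm_normVec (hk _)
  have h2 : ‖inner ℂ (k.kerVec (p i)) (k.kerVec (p j))‖ ^ 2 /
      (‖k.kerVec (p i)‖ ^ 2 * ‖k.kerVec (p j)‖ ^ 2) = ‖inner ℂ b a‖ ^ 2 := by
    rw [norm_inner_symm, inner_normVec_normVec, norm_div, Complex.norm_real, inner_kerVec_kerVec,
      Real.norm_of_nonneg (by positivity), div_pow, mul_pow]
    ring
  rw [h2, @norm_sub_sq ℂ, inner_smul_right, norm_smul, hA, hB, ← inner_conj_symm a b,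
    Complex.mul_conj']
  have h3 : RCLike.re ((‖inner ℂ b a‖ : ℂ) ^ 2) = ‖inner ℂ b a‖ ^ 2 := by
    rw [← Complex.ofReal_pow]
    exact Complex.ofReal_re _
  rw [h3]
  ring

end ReproducingKernel

/-! ### The Szegő kernel -/

/-- The Szegő kernel `1 / (1 - z * conj w)` on the unit disc, the kernel of the Hardy space. -/
noncomputable def szegoKernel : ReproducingKernel 𝔻 where
  toFun z w := 1 / (1 - (z : ℂ) * conj (w : ℂ))
  posSemidef := by
    refine ⟨Matrix.IsHermitian.ext fun z w => ?_, fun x => ?_⟩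
    · simp [mul_comm]
    · have hgeom : ∀ z w : 𝔻, HasSum (fun n : ℕ => ((z : ℂ) * conj (w : ℂ)) ^ n)
          (1 / (1 - (z : ℂ) * conj (w : ℂ))) := fun z w => by
        rw [one_div]
        refine hasSum_geometric_of_norm_lt_one ?_
        rw [norm_mul, RCLike.norm_conj]
        nlinarith [z.norm_lt_one, w.norm_lt_one, norm_nonneg (z : ℂ), norm_nonneg (w : ℂ)]
      have hsum : HasSum (fun n : ℕ => ∑ z ∈ x.support, ∑ w ∈ x.support,
          star (x z) * ((z : ℂ) * conj (w : ℂ)) ^ n * x w)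
          (∑ z ∈ x.support, ∑ w ∈ x.support,
            star (x z) * (1 / (1 - (z : ℂ) * conj (w : ℂ))) * x w) :=
        hasSum_sum fun z _ => hasSum_sum fun w _ => ((hgeom z w).mul_left _).mul_right _
      refine hsum.nonneg fun n => ?_
      -- the `n`-th term of the geometric expansion is the square of a modulus
      have : ∑ z ∈ x.support, ∑ w ∈ x.support,
          star (x z) * ((z : ℂ) * conj (w : ℂ)) ^ n * x w =
          (∑ z ∈ x.support, star (x z) * (z : ℂ) ^ n) *
            star (∑ z ∈ x.support, star (x z) * (z : ℂ) ^ n) := by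
        rw [star_sum, Finset.sum_mul_sum]
        refine Finset.sum_congr rfl fun z _ => Finset.sum_congr rfl fun w _ => ?_
        simp only [star_mul, star_pow, Complex.star_def, mul_pow, Complex.conj_conj]
        ring
      rw [this]
      exact mul_star_self_nonneg _

theorem szegoKernel_apply (z w : 𝔻) :
    szegoKernel z w = 1 / (1 - (z : ℂ) * conj (w : ℂ)) := rfl

theorem szegoKernel_isNormalizedCompletePick : szegoKernel.IsNormalizedCompletePick :=
  ⟨ℂ, inferInstance, inferInstance, inferInstance, fun z => (z : ℂ), fun z => z.norm_lt_one,
    ⟨0, Complex.UnitDisc.coe_zero⟩, fun z w => by rw [szegoKernel_apply]; rfl⟩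

theorem norm_kerVec_szegoKernel_sq (z : 𝔻) :
    ‖szegoKernel.kerVec z‖ ^ 2 = 1 / (1 - ‖(z : ℂ)‖ ^ 2) := by
  have h := szegoKernel.apply_self z
  rw [szegoKernel_apply, Complex.mul_conj'] at h
  exact_mod_cast h.symm

theorem kerVec_szegoKernel_ne_zero (z : 𝔻) : szegoKernel.kerVec z ≠ 0 := by
  rw [← norm_ne_zero_iff, ← sq_pos_iff, norm_kerVec_szegoKernel_sq]
  have := z.sq_norm_lt_one
  exact one_div_pos.2 (by linarith)

/-! ### Simplex kernels of disjoint clusters -/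

section Cluster

variable {ι X : Type*} [DecidableEq X] (C : ι → Finset X)

open Classical in
/-- The real matrix of the simplex kernel of a family of disjoint finite sets `C q` ("clusters"):
`1` on the diagonal, `-1 / (#(C q) - 1)` for two distinct points of the same cluster `C q`, and `0`
otherwise. On each cluster this is the Gram matrix of the unit vectors pointing to the vertices of
a regular simplex, and distinct clusters are orthogonal. The cluster containing two given points is
picked by choice; it is unique when the clusters are disjoint. -/
noncomputable def simplexGram (z w : X) : ℝ :=
  if z = w then 1
  else if h : ∃ q, z ∈ C q ∧ w ∈ C q then -(1 / ((C h.choose).card - 1 : ℝ)) else 0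

theorem simplexGram_self (z : X) : simplexGram C z z = 1 := if_pos rfl

theorem simplexGram_symm (z w : X) : simplexGram C z w = simplexGram C w z := by
  have hPQ : (fun q => z ∈ C q ∧ w ∈ C q) = fun q => w ∈ C q ∧ z ∈ C q :=
    funext fun _ => propext and_comm
  have key : ∀ P Q : ι → Prop, P = Q →
      (open Classical in if h : ∃ q, P q then -(1 / ((C h.choose).card - 1 : ℝ)) else 0) =
      (open Classical in if h : ∃ q, Q q then -(1 / ((C h.choose).card - 1 : ℝ)) else 0) := by
    rintro P _ rfl
    rfl
  rw [simplexGram, simplexGram, key _ _ hPQ]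
  simp only [eq_comm (a := z)]

variable {C}

theorem simplexGram_of_mem (hC : Pairwise fun p q => Disjoint (C p) (C q)) {q : ι} {z w : X}
    (hz : z ∈ C q) (hw : w ∈ C q) (hzw : z ≠ w) :
    simplexGram C z w = -(1 / ((C q).card - 1 : ℝ)) := by
  have h : ∃ q, z ∈ C q ∧ w ∈ C q := ⟨q, hz, hw⟩
  have hq : h.choose = q := by
    by_contra hne
    exact Finset.disjoint_left.1 (hC hne) h.choose_spec.1 hz
  rw [simplexGram, if_neg hzw, dif_pos h, hq]

theorem simplexGram_of_not_mem {z w : X} (hzw : z ≠ w) (h : ∀ q, z ∈ C q → w ∉ C q) :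
    simplexGram C z w = 0 := by
  rw [simplexGram, if_neg hzw, dif_neg (by rintro ⟨q, h1, h2⟩; exact h q h1 h2)]

theorem sum_erase_abs_simplexGram (hC : Pairwise fun p q => Disjoint (C p) (C q))
    {q : ι} {z : X} (hz : z ∈ C q) {F : Finset X} (hzF : z ∈ F) :
    ∑ w ∈ F.erase z, |simplexGram C z w| = ((F ∩ C q).card - 1) / ((C q).card - 1) := by
  have hpos : (1 : ℝ) ≤ (C q).card := by exact_mod_cast Finset.card_pos.2 ⟨z, hz⟩
  rw [← Finset.sum_subset (s₁ := (F ∩ C q).erase z)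
    (Finset.erase_subset_erase _ Finset.inter_subset_left),
    Finset.sum_congr rfl (g := fun _ => 1 / ((C q).card - 1 : ℝ)), Finset.sum_const,
    Finset.card_erase_of_mem (Finset.mem_inter.2 ⟨hzF, hz⟩), nsmul_eq_mul,
    Nat.cast_sub (Finset.card_pos.2 ⟨z, Finset.mem_inter.2 ⟨hzF, hz⟩⟩)]
  · push_cast
    ring
  · intro w hw
    rw [Finset.mem_erase, Finset.mem_inter] at hw
    rw [simplexGram_of_mem hC hz hw.2.2 hw.1.symm, abs_neg, abs_of_nonneg]
    exact one_div_nonneg.2 (by linarith)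
  · intro w hw hw'
    rw [Finset.mem_erase] at hw
    rw [simplexGram_of_not_mem hw.1.symm, abs_zero]
    intro q' hzq' hwq'
    have : q' = q := by
      by_contra hne
      exact Finset.disjoint_left.1 (hC hne) hzq' hz
    subst this
    exact hw' (Finset.mem_erase.2 ⟨hw.1, Finset.mem_inter.2 ⟨hw.2, hwq'⟩⟩)

theorem sum_erase_abs_simplexGram_le_one (hC : Pairwise fun p q => Disjoint (C p) (C q))
    (F : Finset X) (z : X) (hzF : z ∈ F) : ∑ w ∈ F.erase z, |simplexGram C z w| ≤ 1 := by
  by_cases hz : ∃ q, z ∈ C q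
  · obtain ⟨q, hz⟩ := hz
    rw [sum_erase_abs_simplexGram hC hz hzF]
    have hpos : (1 : ℝ) ≤ (C q).card := by exact_mod_cast Finset.card_pos.2 ⟨z, hz⟩
    have hle : ((F ∩ C q).card : ℝ) ≤ (C q).card := by
      exact_mod_cast Finset.card_le_card Finset.inter_subset_right
    exact div_le_one_of_le₀ (by linarith) (by linarith)
  · push Not at hz
    rw [Finset.sum_eq_zero]
    · exact zero_le_one
    · intro w hw
      rw [simplexGram_of_not_mem (Finset.ne_of_mem_erase hw).symm fun q h => (hz q h).elim,
        abs_zero]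

namespace ReproducingKernel

/-- The pointwise product of a kernel with the simplex kernel of a family of disjoint clusters. -/
noncomputable def mulSimplex (k : ReproducingKernel X)
    (hC : Pairwise fun p q => Disjoint (C p) (C q)) : ReproducingKernel X where
  toFun z w := k z w * (simplexGram C z w : ℂ)
  posSemidef := by
    refine posSemidef_of_diagDominant _ (fun z w => ?_) (fun z => ‖k.kerVec z‖)
      (fun z w => |simplexGram C z w|) (fun _ _ => abs_nonneg _)
      (fun z w => by rw [simplexGram_symm]) (fun z => ?_) (fun z w _ => ?_)
      (sum_erase_abs_simplexGram_le_one hC)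
    · rw [star_mul', k.star_apply, simplexGram_symm, Complex.star_def, Complex.conj_ofReal]
    · rw [simplexGram_self, k.apply_self]
      simp
    · rw [norm_mul, Complex.norm_real, Real.norm_eq_abs, mul_comm]
      exact mul_le_mul_of_nonneg_left (k.norm_apply_le z w) (abs_nonneg _)

/-- The simplex kernel of a family of disjoint clusters. -/
noncomputable def simplex (hC : Pairwise fun p q => Disjoint (C p) (C q)) :
    ReproducingKernel X where
  toFun z w := (simplexGram C z w : ℂ)
  posSemidef := by
    refine posSemidef_of_diagDominant _ (fun z w => ?_) (fun _ => 1)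
      (fun z w => |simplexGram C z w|) (fun _ _ => abs_nonneg _)
      (fun z w => by rw [simplexGram_symm]) (fun z => ?_) (fun z w _ => ?_)
      (sum_erase_abs_simplexGram_le_one hC)
    · rw [simplexGram_symm, Complex.star_def, Complex.conj_ofReal]
    · rw [simplexGram_self]
      simp
    · rw [Complex.norm_real, Real.norm_eq_abs, mul_one, mul_one]

variable (k : ReproducingKernel X) (hC : Pairwise fun p q => Disjoint (C p) (C q))

theorem mulSimplex_apply (z w : X) :
    k.mulSimplex hC z w = k z w * (simplexGram C z w : ℂ) := rfl

theorem norm_kerVec_mulSimplex (z : X) : ‖(k.mulSimplex hC).kerVec z‖ = ‖k.kerVec z‖ := by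
  have h := (k.mulSimplex hC).apply_self z
  rw [mulSimplex_apply, simplexGram_self, k.apply_self, Complex.ofReal_one, mul_one] at h
  exact ((sq_eq_sq₀ (norm_nonneg _) (norm_nonneg _)).1 (Complex.ofReal_injective h)).symm

theorem inner_normVec_mulSimplex (z w : X) :
    inner ℂ ((k.mulSimplex hC).normVec z) ((k.mulSimplex hC).normVec w) =
      inner ℂ (k.normVec z) (k.normVec w) * (simplexGram C z w : ℂ) := by
  rw [inner_normVec_normVec, inner_normVec_normVec, norm_kerVec_mulSimplex,
    norm_kerVec_mulSimplex, mulSimplex_apply]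
  ring

variable {k}

/-- Any `n` points lying in clusters of `n + 1` points are `n`-separated with the constant
`1 / n`: the off-diagonal row sums of their normalized Gram matrix are at most `(n - 1) / n`. -/
theorem nWeaklySeparated_mulSimplex (hk : ∀ z, k.kerVec z ≠ 0) {n : ℕ} (hn : 0 < n) {p : ℕ → X}
    (hp : ∀ i, ∃ q, p i ∈ C q ∧ (C q).card = n + 1) :
    (k.mulSimplex hC).NWeaklySeparated n p := by
  have hn' : (0 : ℝ) < n := by exact_mod_cast hn
  have hl : ∀ z, (k.mulSimplex hC).kerVec z ≠ 0 := fun z => by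
    rw [← norm_ne_zero_iff, norm_kerVec_mulSimplex]
    exact norm_ne_zero_iff.2 (hk z)
  set l := k.mulSimplex hC with hldef
  refine ⟨1 / n, by positivity, fun S hS hSp x hx => ?_⟩
  refine (Metric.le_infDist ⟨0, Submodule.zero_mem _⟩).2 fun y hy => ?_
  have hcoe : ((S : Set X) \ {x}) = ((S.erase x : Finset X) : Set X) := by simp
  rw [SetLike.mem_coe, hcoe, Submodule.mem_span_image_finset_iff_exists_fun'] at hy
  obtain ⟨c, rfl⟩ := hy
  set c' : X → ℂ := fun z => if z = x then 1 else -c z with hc'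
  have hsum : l.normVec x - ∑ z ∈ S.erase x, c z • l.normVec z = ∑ z ∈ S, c' z • l.normVec z := by
    rw [← Finset.add_sum_erase _ _ hx, sub_eq_add_neg, ← Finset.sum_neg_distrib]
    congr 1
    · simp [hc']
    · refine Finset.sum_congr rfl fun z hz => ?_
      simp only [hc', if_neg (Finset.ne_of_mem_erase hz), neg_smul]
  rw [dist_eq_norm, hsum]
  have hrow : ∀ z ∈ S, ∑ w ∈ S.erase z, |simplexGram C z w| ≤ 1 - 1 / n := by
    intro z hz
    obtain ⟨i, rfl⟩ := hSp hz
    obtain ⟨q, hq, hcard⟩ := hp i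
    rw [sum_erase_abs_simplexGram hC hq hz, hcard]
    have : ((S ∩ C q).card : ℝ) ≤ n := by
      rw [← hS]
      exact_mod_cast Finset.card_le_card Finset.inter_subset_left
    push_cast
    rw [add_sub_cancel_right, ← div_self hn'.ne', ← sub_div]
    gcongr
  have hlow := one_sub_mul_le_re_sum S (fun z w => inner ℂ (l.normVec z) (l.normVec w))
    (fun _ => 1) (fun z w => |simplexGram C z w|) (fun _ _ => abs_nonneg _)
    (fun z w => by rw [simplexGram_symm])
    (fun z => by rw [inner_self_eq_norm_sq_to_K, l.norm_normVec (hl z)]; simp)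
    (fun z w _ => by
      rw [hldef, inner_normVec_mulSimplex, norm_mul, Complex.norm_real, Real.norm_eq_abs, mul_comm]
      refine mul_le_mul_of_nonneg_left ((norm_inner_le_norm _ _).trans ?_) (abs_nonneg _)
      rw [k.norm_normVec (hk z), k.norm_normVec (hk w)]) _ hrow c'
  rw [← normSq_sum_smul_normVec] at hlow
  have h1 : (1 : ℝ) ≤ ∑ z ∈ S, (‖c' z‖ * 1) ^ 2 :=
    le_trans (by simp [hc']) (Finset.single_le_sum (f := fun z => (‖c' z‖ * 1) ^ 2)
      (fun z _ => sq_nonneg _) hx)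
  have h2 : (1 / n : ℝ) ≤ 1 := by
    rw [div_le_one hn']
    exact_mod_cast hn
  have h3 : (0 : ℝ) < 1 / n := by positivity
  refine abs_le_of_sq_le_sq' ?_ (norm_nonneg _) |>.2
  nlinarith

/-- The sum of the normalized kernel functions over a cluster is small when the original
normalized kernel functions are nearly equal there, since the vertices of a centered simplex add up
to zero. -/
theorem normSq_sum_normVec_mulSimplex_le (hk : ∀ z, k.kerVec z ≠ 0) {q : ι} {n : ℕ} (hn : 0 < n)
    (hcard : (C q).card = n + 1) {η : ℝ}
    (hη : ∀ z ∈ C q, ∀ w ∈ C q, 1 - η ≤ (inner ℂ (k.normVec z) (k.normVec w)).re) :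
    ‖∑ z ∈ C q, (k.mulSimplex hC).normVec z‖ ^ 2 ≤ (n + 1) * η := by
  have hn' : (0 : ℝ) < n := by exact_mod_cast hn
  have h := (k.mulSimplex hC).normSq_sum_smul_normVec (C q) (fun _ => 1)
  simp only [one_smul, star_one, one_mul, mul_one] at h
  rw [h, Complex.re_sum]
  have : ∀ z ∈ C q, (∑ w ∈ C q, inner ℂ ((k.mulSimplex hC).normVec z)
      ((k.mulSimplex hC).normVec w)).re ≤ η := by
    intro z hz
    rw [← Finset.add_sum_erase _ _ hz, Complex.add_re, inner_normVec_mulSimplex,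
      simplexGram_self, inner_self_eq_norm_sq_to_K, k.norm_normVec (hk z), Complex.re_sum]
    have h2 : ∀ w ∈ (C q).erase z, (inner ℂ ((k.mulSimplex hC).normVec z)
        ((k.mulSimplex hC).normVec w)).re ≤ -((1 - η) / n) := by
      intro w hw
      rw [Finset.mem_erase] at hw
      rw [inner_normVec_mulSimplex, simplexGram_of_mem hC hz hw.2 hw.1.symm, hcard,
        Complex.re_mul_ofReal]
      push_cast
      rw [add_sub_cancel_right, mul_neg, neg_le_neg_iff, mul_one_div]
      gcongr
      exact hη z hz w hw.2
    have h3 := Finset.sum_le_sum h2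
    rw [Finset.sum_const, Finset.card_erase_of_mem hz, hcard, Nat.add_sub_cancel, nsmul_eq_mul,
      mul_neg, mul_div_cancel₀ _ hn'.ne'] at h3
    simp only [Complex.coe_algebraMap, Complex.ofReal_one, one_pow, mul_one, Complex.one_re]
    linarith
  refine (Finset.sum_le_sum this).trans (le_of_eq ?_)
  rw [Finset.sum_const, hcard, nsmul_eq_mul]
  push_cast
  ring

end ReproducingKernel

end Cluster

/-! ### Clusters of radial points in the disc -/

theorem exists_inner_normVec_szegoKernel_radial {z w : 𝔻} {δ ε : ℝ}
    (hδ0 : 0 < δ) (hδ1 : δ < 1) (hε0 : 0 < ε) (hε1 : ε < 1)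
    (hz : (z : ℂ) = ((1 - δ : ℝ) : ℂ)) (hw : (w : ℂ) = ((1 - ε : ℝ) : ℂ)) :
    ∃ r : ℝ, 0 ≤ r ∧ inner ℂ (szegoKernel.normVec z) (szegoKernel.normVec w) = (r : ℂ) ∧
      r ^ 2 * (δ + ε - δ * ε) ^ 2 = (2 * δ - δ ^ 2) * (2 * ε - ε ^ 2) := by
  have hD : 0 < δ + ε - δ * ε := by nlinarith
  have hsq : ∀ {x : 𝔻} {η : ℝ}, 0 < η → η < 1 → (x : ℂ) = ((1 - η : ℝ) : ℂ) →
      ‖szegoKernel.kerVec x‖ ^ 2 = 1 / (2 * η - η ^ 2) := fun {x η} h0 h1 hx => by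
    rw [norm_kerVec_szegoKernel_sq, hx, Complex.norm_real, Real.norm_eq_abs, sq_abs]
    congr 1
    ring
  refine ⟨1 / (δ + ε - δ * ε) / (‖szegoKernel.kerVec z‖ * ‖szegoKernel.kerVec w‖),
    by positivity, ?_, ?_⟩
  · rw [ReproducingKernel.inner_normVec_normVec, szegoKernel_apply, hz, hw, Complex.conj_ofReal]
    push_cast
    congr 2
    ring
  · rw [div_pow, mul_pow, hsq hδ0 hδ1 hz, hsq hε0 hε1 hw]
    have h1 : 0 < 2 * δ - δ ^ 2 := by nlinarith
    have h2 : 0 < 2 * ε - ε ^ 2 := by nlinarith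
    field_simp

/-- The normalized Szegő kernel functions at `1 - δ` and `1 - ε` are nearly orthogonal when
`ε` is much smaller than `δ`. -/
theorem norm_inner_normVec_szegoKernel_le {z w : 𝔻} {δ ε : ℝ}
    (hδ0 : 0 < δ) (hδ1 : δ < 1) (hε0 : 0 < ε) (hε1 : ε < 1)
    (hz : (z : ℂ) = ((1 - δ : ℝ) : ℂ)) (hw : (w : ℂ) = ((1 - ε : ℝ) : ℂ)) {c : ℝ} (hc : 0 ≤ c)
    (h : 4 * ε ≤ c ^ 2 * δ) :
    ‖inner ℂ (szegoKernel.normVec z) (szegoKernel.normVec w)‖ ≤ c := by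
  obtain ⟨r, hr0, hr, hr2⟩ := exists_inner_normVec_szegoKernel_radial hδ0 hδ1 hε0 hε1 hz hw
  rw [hr, Complex.norm_real, Real.norm_of_nonneg hr0]
  refine abs_le_of_sq_le_sq' ?_ hc |>.2
  have h1 : r ^ 2 * δ ^ 2 ≤ c ^ 2 * δ ^ 2 := by
    calc r ^ 2 * δ ^ 2 ≤ r ^ 2 * (δ + ε - δ * ε) ^ 2 := by
          gcongr
          nlinarith
      _ = (2 * δ - δ ^ 2) * (2 * ε - ε ^ 2) := hr2
      _ ≤ (2 * δ) * (2 * ε) := by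
          refine mul_le_mul ?_ ?_ ?_ ?_ <;> nlinarith
      _ = δ * (4 * ε) := by ring
      _ ≤ δ * (c ^ 2 * δ) := by gcongr
      _ = c ^ 2 * δ ^ 2 := by ring
  exact le_of_mul_le_mul_right h1 (by positivity)

/-- The normalized Szegő kernel functions at `1 - δ` and `1 - ε` are nearly equal when `δ` and `ε`
are nearly equal. -/
theorem le_re_inner_normVec_szegoKernel {z w : 𝔻} {δ ε : ℝ}
    (hε0 : 0 < ε) (hδ1 : δ < 1) (hεδ : ε ≤ δ)
    (hz : (z : ℂ) = ((1 - δ : ℝ) : ℂ)) (hw : (w : ℂ) = ((1 - ε : ℝ) : ℂ)) {c : ℝ}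
    (h : c * δ ≤ ε) :
    c ≤ (inner ℂ (szegoKernel.normVec z) (szegoKernel.normVec w)).re := by
  have hδ0 : 0 < δ := hε0.trans_le hεδ
  have hε1 : ε < 1 := hεδ.trans_lt hδ1
  obtain ⟨r, hr0, hr, hr2⟩ := exists_inner_normVec_szegoKernel_radial hδ0 hδ1 hε0 hε1 hz hw
  rw [hr, Complex.ofReal_re]
  refine le_of_mul_le_mul_right (h.trans ?_) hδ0
  have h2 : 0 < 2 - δ := by linarith
  refine le_of_mul_le_mul_right ?_ h2
  -- `ε (2 - δ) ≤ 2 ε - ε² ≤ r (δ + ε - δ ε) ≤ r (2 δ - δ²)`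
  have h3 : 2 * ε - ε ^ 2 ≤ r * (δ + ε - δ * ε) := by
    refine abs_le_of_sq_le_sq' ?_ (mul_nonneg hr0 (by nlinarith)) |>.2
    rw [mul_pow, hr2, sq]
    refine mul_le_mul_of_nonneg_right ?_ (by nlinarith)
    nlinarith
  have h4 : r * (δ + ε - δ * ε) ≤ r * (2 * δ - δ ^ 2) :=
    mul_le_mul_of_nonneg_left (by nlinarith) hr0
  nlinarith

/-- The distance to the unit circle of the `i`-th point of the `j`-th cluster of type `n`. With
`m = Nat.pair n j` it lies between `4 ^ (-(m ^ 2 + 1)) / 2` and `4 ^ (-(m ^ 2 + 1))`, and within a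
cluster the ratios of these distances are at least `1 - 1 / (j + 1)`. -/
noncomputable def clusterGap (n j : ℕ) (i : Fin (n + 1)) : ℝ :=
  (1 / 4) ^ (Nat.pair n j ^ 2 + 1) * (1 - i / (2 * (n + 1) * (j + 1)))

section Gap

variable (n j : ℕ) (i : Fin (n + 1))

theorem div_le_half_inv : (i : ℝ) / (2 * (n + 1) * (j + 1)) ≤ 1 / (2 * (j + 1)) := by
  have hi : (i : ℝ) ≤ n + 1 := by exact_mod_cast i.2.le
  rw [div_le_div_iff₀ (by positivity) (by positivity), one_mul]
  calc (i : ℝ) * (2 * (j + 1)) ≤ (n + 1) * (2 * (j + 1)) := by gcongr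
    _ = _ := by ring

theorem clusterGap_le : clusterGap n j i ≤ (1 / 4) ^ (Nat.pair n j ^ 2 + 1) := by
  refine mul_le_of_le_one_right (by positivity) ?_
  have : (0 : ℝ) ≤ (i : ℝ) / (2 * (n + 1) * (j + 1)) := by positivity
  linarith

theorem one_sub_mul_le_clusterGap :
    (1 - 1 / (j + 1)) * (1 / 4) ^ (Nat.pair n j ^ 2 + 1) ≤ clusterGap n j i := by
  rw [clusterGap, mul_comm]
  refine mul_le_mul_of_nonneg_left (sub_le_sub_left ((div_le_half_inv n j i).trans ?_) 1)
    (by positivity)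
  gcongr
  linarith [(j.cast_nonneg : (0 : ℝ) ≤ j)]

theorem half_mul_le_clusterGap :
    1 / 2 * (1 / 4) ^ (Nat.pair n j ^ 2 + 1) ≤ clusterGap n j i := by
  rw [clusterGap, mul_comm]
  gcongr
  have h : (1 : ℝ) / (2 * (j + 1)) ≤ 1 / 2 := by
    gcongr
    have : (0 : ℝ) ≤ j := j.cast_nonneg
    linarith
  linarith [div_le_half_inv n j i]

theorem clusterGap_pos : 0 < clusterGap n j i :=
  lt_of_lt_of_le (by positivity) (half_mul_le_clusterGap n j i)

theorem clusterGap_lt_one : clusterGap n j i < 1 :=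
  (clusterGap_le n j i).trans_lt (pow_lt_one₀ (by norm_num) (by norm_num) (by simp))

variable {n j}

/-- Different clusters are far apart: the quadratic growth of the exponents in `clusterGap` makes
the quotient of two gaps at most `2 * 4 ^ (-(m + m'))`. -/
theorem clusterGap_le_of_pair_lt {n' j' : ℕ} (h : Nat.pair n j < Nat.pair n' j')
    (i' : Fin (n' + 1)) :
    clusterGap n' j' i' ≤ 2 * (1 / 4) ^ (Nat.pair n j + Nat.pair n' j') * clusterGap n j i := by
  calc clusterGap n' j' i' ≤ (1 / 4) ^ (Nat.pair n' j' ^ 2 + 1) := clusterGap_le _ _ _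
    _ ≤ (1 / 4) ^ (Nat.pair n j + Nat.pair n' j' + (Nat.pair n j ^ 2 + 1)) :=
        pow_le_pow_of_le_one (by norm_num) (by norm_num) (by nlinarith)
    _ = 2 * (1 / 4) ^ (Nat.pair n j + Nat.pair n' j') *
          (1 / 2 * (1 / 4) ^ (Nat.pair n j ^ 2 + 1)) := by rw [pow_add]; ring
    _ ≤ _ := by gcongr; exact half_mul_le_clusterGap n j i

theorem clusterGap_lt_of_pair_lt {n' j' : ℕ} (h : Nat.pair n j < Nat.pair n' j')
    (i' : Fin (n' + 1)) : clusterGap n' j' i' < clusterGap n j i := by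
  refine (clusterGap_le_of_pair_lt i h i').trans_lt
    (mul_lt_of_lt_one_left (clusterGap_pos n j i) ?_)
  have : ((1 : ℝ) / 4) ^ (Nat.pair n j + Nat.pair n' j') ≤ (1 / 4) ^ 1 :=
    pow_le_pow_of_le_one (by norm_num) (by norm_num) (by omega)
  linarith

theorem pair_eq_of_clusterGap_eq {n' j' : ℕ} {i' : Fin (n' + 1)}
    (h : clusterGap n j i = clusterGap n' j' i') : n = n' ∧ j = j' := by
  rw [← Nat.pair_eq_pair]
  rcases lt_trichotomy (Nat.pair n j) (Nat.pair n' j') with hlt | heq | hlt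
  · exact absurd h (clusterGap_lt_of_pair_lt i hlt i').ne'
  · exact heq
  · exact absurd h (clusterGap_lt_of_pair_lt i' hlt i).ne

theorem clusterGap_injective (n j : ℕ) : Function.Injective (clusterGap n j) := by
  intro i i' h
  have h1 := mul_left_cancel₀ (by positivity) h
  have h2 : (i : ℝ) / (2 * (n + 1) * (j + 1)) = i' / (2 * (n + 1) * (j + 1)) := by linarith
  rw [div_left_inj' (by positivity)] at h2
  exact Fin.ext (by exact_mod_cast h2)

end Gap

/-- The `i`-th point of the `j`-th cluster of type `n`. -/
noncomputable def clusterPoint (n j : ℕ) (i : Fin (n + 1)) : 𝔻 :=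
  Complex.UnitDisc.mk ((1 - clusterGap n j i : ℝ) : ℂ) (by
    rw [Complex.norm_real, Real.norm_eq_abs, abs_lt]
    constructor <;> linarith [clusterGap_pos n j i, clusterGap_lt_one n j i])

theorem coe_clusterPoint (n j : ℕ) (i : Fin (n + 1)) :
    (clusterPoint n j i : ℂ) = ((1 - clusterGap n j i : ℝ) : ℂ) := Complex.UnitDisc.coe_mk _ _

theorem clusterGap_eq_of_clusterPoint_eq {n j n' j' : ℕ} {i : Fin (n + 1)} {i' : Fin (n' + 1)}
    (h : clusterPoint n j i = clusterPoint n' j' i') : clusterGap n j i = clusterGap n' j' i' := by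
  have h1 : (clusterPoint n j i : ℂ) = clusterPoint n' j' i' := by rw [h]
  rw [coe_clusterPoint, coe_clusterPoint] at h1
  linarith [Complex.ofReal_injective h1]

theorem clusterPoint_injective (n j : ℕ) : Function.Injective (clusterPoint n j) :=
  fun _ _ h => clusterGap_injective n j (clusterGap_eq_of_clusterPoint_eq h)

open Classical in
/-- The `q.2`-th cluster of type `q.1`, a set of `q.1 + 1` points. -/
noncomputable def cluster (q : ℕ × ℕ) : Finset 𝔻 :=
  Finset.univ.image (clusterPoint q.1 q.2)

theorem mem_cluster {q : ℕ × ℕ} {z : 𝔻} : z ∈ cluster q ↔ ∃ i, clusterPoint q.1 q.2 i = z := by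
  simp [cluster]

theorem card_cluster (q : ℕ × ℕ) : (cluster q).card = q.1 + 1 := by
  classical
  rw [cluster, Finset.card_image_of_injective _ (clusterPoint_injective _ _), Finset.card_univ,
    Fintype.card_fin]

theorem pairwise_disjoint_cluster : Pairwise fun p q => Disjoint (cluster p) (cluster q) := by
  intro p q hpq
  refine Finset.disjoint_left.2 fun z hp hq => hpq ?_
  obtain ⟨i, rfl⟩ := mem_cluster.1 hp
  obtain ⟨i', h⟩ := mem_cluster.1 hq
  exact Prod.ext_iff.2 (pair_eq_of_clusterGap_eq _ (clusterGap_eq_of_clusterPoint_eq h.symm))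

theorem le_re_inner_normVec_of_mem_cluster {n j : ℕ} {z w : 𝔻} (hz : z ∈ cluster (n, j))
    (hw : w ∈ cluster (n, j)) :
    1 - 1 / (j + 1 : ℝ) ≤ (inner ℂ (szegoKernel.normVec z) (szegoKernel.normVec w)).re := by
  obtain ⟨i, rfl⟩ := mem_cluster.1 hz
  obtain ⟨i', rfl⟩ := mem_cluster.1 hw
  have hj : (0 : ℝ) ≤ 1 - 1 / (j + 1) := by
    rw [sub_nonneg, div_le_one (by positivity)]
    linarith [(j.cast_nonneg : (0 : ℝ) ≤ j)]
  have key : ∀ i i', (1 - 1 / (j + 1 : ℝ)) * clusterGap n j i ≤ clusterGap n j i' := fun i i' =>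
    (mul_le_mul_of_nonneg_left (clusterGap_le n j i) hj).trans (one_sub_mul_le_clusterGap n j i')
  rcases le_total (clusterGap n j i') (clusterGap n j i) with h | h
  · exact le_re_inner_normVec_szegoKernel (clusterGap_pos _ _ _) (clusterGap_lt_one _ _ _) h
      (coe_clusterPoint _ _ _) (coe_clusterPoint _ _ _) (key _ _)
  · rw [← inner_conj_symm, Complex.conj_re]
    exact le_re_inner_normVec_szegoKernel (clusterGap_pos _ _ _) (clusterGap_lt_one _ _ _) h
      (coe_clusterPoint _ _ _) (coe_clusterPoint _ _ _) (key _ _)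

theorem norm_inner_normVec_clusterPoint_le {n j j' : ℕ} (i i' : Fin (n + 1)) (hj : j ≠ j') :
    ‖inner ℂ (szegoKernel.normVec (clusterPoint n j i))
      (szegoKernel.normVec (clusterPoint n j' i'))‖ ≤ 4 * (1 / 2) ^ j' := by
  have key : ∀ {j j' : ℕ} (i i' : Fin (n + 1)), Nat.pair n j < Nat.pair n j' →
      ‖inner ℂ (szegoKernel.normVec (clusterPoint n j i))
        (szegoKernel.normVec (clusterPoint n j' i'))‖ ≤
        4 * (1 / 2) ^ (Nat.pair n j + Nat.pair n j') := by
    intro j j' i i' h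
    refine norm_inner_normVec_szegoKernel_le (clusterGap_pos _ _ _) (clusterGap_lt_one _ _ _)
      (clusterGap_pos _ _ _) (clusterGap_lt_one _ _ _)
      (coe_clusterPoint _ _ _) (coe_clusterPoint _ _ _) (by positivity) ?_
    have h1 := clusterGap_le_of_pair_lt i h i'
    have h2 : (4 * (1 / 2 : ℝ) ^ (Nat.pair n j + Nat.pair n j')) ^ 2 =
        16 * (1 / 4) ^ (Nat.pair n j + Nat.pair n j') := by
      rw [mul_pow, ← pow_mul, mul_comm _ 2, pow_mul]
      norm_num
    rw [h2]
    have h3 : 0 ≤ (1 / 4 : ℝ) ^ (Nat.pair n j + Nat.pair n j') * clusterGap n j i :=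
      mul_nonneg (by positivity) (clusterGap_pos _ _ _).le
    linarith
  have hle : (4 : ℝ) * (1 / 2) ^ (Nat.pair n j + Nat.pair n j') ≤ 4 * (1 / 2) ^ j' := by
    gcongr 4 * ?_
    exact pow_le_pow_of_le_one (by norm_num) (by norm_num)
      ((Nat.right_le_pair n j').trans (Nat.le_add_left _ _))
  refine le_trans ?_ hle
  rcases lt_or_gt_of_ne (fun h => hj (Nat.pair_eq_pair.1 h).2 :
    Nat.pair n j ≠ Nat.pair n j') with h | h
  · exact key i i' h
  · rw [norm_inner_symm, add_comm]
    exact key i' i h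

/-- The sequence running through all clusters of type `n`. -/
noncomputable def clusterSeq (n : ℕ) : ℕ → 𝔻 :=
  (fun x : ℕ × Fin (n + 1) => clusterPoint n x.1 x.2) ∘ Nat.divModEquiv (n + 1)

theorem clusterSeq_injective (n : ℕ) : Function.Injective (clusterSeq n) := by
  refine Function.Injective.comp ?_ (Equiv.injective _)
  rintro ⟨j, i⟩ ⟨j', i'⟩ h
  obtain rfl := (pair_eq_of_clusterGap_eq _ (clusterGap_eq_of_clusterPoint_eq h)).2
  exact Prod.ext rfl (clusterPoint_injective _ _ h)

theorem clusterSeq_symm_apply (n j : ℕ) (i : Fin (n + 1)) :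
    clusterSeq n ((Nat.divModEquiv (n + 1)).symm (j, i)) = clusterPoint n j i := by
  rw [clusterSeq, Function.comp_apply, Equiv.apply_symm_apply]

theorem clusterSeq_mem_cluster (n m : ℕ) :
    clusterSeq n m ∈ cluster (n, (Nat.divModEquiv (n + 1) m).1) :=
  mem_cluster.2 ⟨_, rfl⟩

theorem szegoKernel_carlesonCondition_clusterSeq (n : ℕ) :
    szegoKernel.CarlesonCondition (clusterSeq n) := by
  refine ReproducingKernel.CarlesonCondition.of_rowSum_le _ _ _ (ρ := (n + 1) * 9)
    (by positivity) ?_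
  rintro F ⟨j, i⟩ -
  set g : ℕ → ℝ := fun m => (if m = j then 1 else 0) + 4 * (1 / 2) ^ m with hg
  have hentry : ∀ x : ℕ × Fin (n + 1), ‖inner ℂ (szegoKernel.normVec (clusterPoint n j i))
      (szegoKernel.normVec (clusterPoint n x.1 x.2))‖ ≤ g x.1 := by
    intro x
    simp only [hg]
    split_ifs with h
    · refine (norm_inner_le_norm _ _).trans ?_
      rw [ReproducingKernel.norm_normVec _ (kerVec_szegoKernel_ne_zero _),
        ReproducingKernel.norm_normVec _ (kerVec_szegoKernel_ne_zero _), mul_one]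
      exact le_add_of_nonneg_right (by positivity)
    · rw [zero_add]
      exact norm_inner_normVec_clusterPoint_le i x.2 (Ne.symm h)
  have hnn : ∀ x : ℕ × Fin (n + 1), 0 ≤ g x.1 := fun x => by
    simp only [hg]
    split_ifs <;> positivity
  obtain ⟨N, hN⟩ : ∃ N, F ⊆ Finset.range N ×ˢ Finset.univ := by
    obtain ⟨N, hN⟩ := (F.image Prod.fst).exists_nat_subset_range
    exact ⟨N, fun x hx => Finset.mem_product.2
      ⟨hN (Finset.mem_image_of_mem _ hx), Finset.mem_univ _⟩⟩
  refine (Finset.sum_le_sum fun x _ => hentry x).trans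
    ((Finset.sum_le_sum_of_subset_of_nonneg hN fun x _ _ => hnn x).trans ?_)
  rw [Finset.sum_product]
  simp only [Finset.sum_const, Finset.card_univ, Fintype.card_fin, nsmul_eq_mul, Nat.cast_add,
    Nat.cast_one]
  rw [← Finset.mul_sum, Finset.sum_add_distrib, ← Finset.mul_sum]
  gcongr
  have h1 : ∑ x ∈ Finset.range N, (if x = j then (1 : ℝ) else 0) ≤ 1 := by
    rw [Finset.sum_ite_eq']
    split_ifs <;> norm_num
  have h2 : ∑ x ∈ Finset.range N, ((1 : ℝ) / 2) ^ x ≤ 2 := sum_geometric_two_le N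
  linarith

/-! ### The counterexample -/

open Classical in
/-- The product of the Szegő kernel with the simplex kernel of the radial clusters. -/
noncomputable def szegoSimplexKernel : ReproducingKernel 𝔻 :=
  szegoKernel.mulSimplex pairwise_disjoint_cluster

open Classical in
theorem norm_kerVec_szegoSimplexKernel (z : 𝔻) :
    ‖szegoSimplexKernel.kerVec z‖ = ‖szegoKernel.kerVec z‖ :=
  ReproducingKernel.norm_kerVec_mulSimplex _ _ _

theorem kerVec_szegoSimplexKernel_ne_zero (z : 𝔻) : szegoSimplexKernel.kerVec z ≠ 0 := by
  rw [← norm_ne_zero_iff, norm_kerVec_szegoSimplexKernel]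
  exact norm_ne_zero_iff.2 (kerVec_szegoKernel_ne_zero z)

open Classical in
theorem nWeaklySeparated_clusterSeq {n : ℕ} (hn : 0 < n) :
    szegoSimplexKernel.NWeaklySeparated n (clusterSeq n) :=
  ReproducingKernel.nWeaklySeparated_mulSimplex _ kerVec_szegoKernel_ne_zero hn
    fun m => ⟨_, clusterSeq_mem_cluster n m, card_cluster _⟩

open Classical in
/-- The simplex relation holds asymptotically along the clusters of each type. -/
theorem exists_norm_sum_cluster_lt {n : ℕ} (hn : 0 < n) {ε : ℝ} (hε : 0 < ε) :
    ∃ j, ‖∑ z ∈ cluster (n, j), szegoSimplexKernel.normVec z‖ < ε := by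
  obtain ⟨j, hj⟩ := exists_nat_gt ((n + 1) / ε ^ 2)
  refine ⟨j, lt_of_pow_lt_pow_left₀ 2 hε.le ?_⟩
  refine (ReproducingKernel.normSq_sum_normVec_mulSimplex_le pairwise_disjoint_cluster
    kerVec_szegoKernel_ne_zero hn (card_cluster (n, j)) (η := 1 / (j + 1))
    fun z hz w hw => le_re_inner_normVec_of_mem_cluster hz hw).trans_lt ?_
  rw [div_lt_iff₀ (by positivity)] at hj
  rw [mul_one_div, div_lt_iff₀ (by positivity)]
  nlinarith [sq_pos_of_pos hε]

theorem not_nWeaklySeparated_succ_clusterSeq {n : ℕ} (hn : 0 < n) :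
    ¬ szegoSimplexKernel.NWeaklySeparated (n + 1) (clusterSeq n) := by
  classical
  rintro ⟨ε, hε, H⟩
  obtain ⟨j, hj⟩ := exists_norm_sum_cluster_lt hn hε
  have hx : clusterPoint n j 0 ∈ cluster (n, j) := mem_cluster.2 ⟨0, rfl⟩
  have h1 := H (cluster (n, j)) (card_cluster _) (fun z hz => by
    obtain ⟨i, rfl⟩ := mem_cluster.1 hz
    exact ⟨_, clusterSeq_symm_apply n j i⟩) _ hx
  have hy : -∑ z ∈ (cluster (n, j)).erase (clusterPoint n j 0), szegoSimplexKernel.normVec z ∈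
      Submodule.span ℂ (szegoSimplexKernel.normVec ''
        ((cluster (n, j) : Set 𝔻) \ {clusterPoint n j 0})) :=
    Submodule.neg_mem _ (Submodule.sum_mem _ fun z hz =>
      Submodule.subset_span ⟨z, by simpa [and_comm] using hz, rfl⟩)
  have h2 := h1.trans (Metric.infDist_le_dist_of_mem hy)
  rw [dist_eq_norm, sub_neg_eq_add, Finset.add_sum_erase _ _ hx] at h2
  exact absurd hj (not_lt.2 h2)

/-- The adjoint of a multiplier that interpolates the indicator of one point in each cluster sends
the small vectors `∑ z ∈ cluster q, l_z / ‖l_z‖` to unit vectors, so it is unbounded. -/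
theorem not_isInterpolating_clusterSeq {n : ℕ} (hn : 0 < n) :
    ¬ ReproducingKernel.IsInterpolating szegoKernel szegoSimplexKernel (clusterSeq n) := by
  classical
  intro H
  obtain ⟨φ, ⟨M, hM⟩, hφ⟩ := H (fun m => if (Nat.divModEquiv (n + 1) m).2 = 0 then 1 else 0)
    ⟨1, fun m => by split_ifs <;> simp⟩
  obtain ⟨j, hj⟩ := exists_norm_sum_cluster_lt hn (inv_pos.2 (by positivity : 0 < ‖M‖ + 1))
  set x := clusterPoint n j 0 with hxdef
  set f := szegoKernel.normVec x with hf
  have hx : x ∈ cluster (n, j) := mem_cluster.2 ⟨0, rfl⟩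
  have hval : ∀ z ∈ cluster (n, j), φ z = if z = x then 1 else 0 := by
    intro z hz
    obtain ⟨i, rfl⟩ := mem_cluster.1 hz
    have h := hφ ((Nat.divModEquiv (n + 1)).symm (j, i))
    rw [clusterSeq_symm_apply, norm_kerVec_szegoSimplexKernel,
      div_self (norm_ne_zero_iff.2 (kerVec_szegoKernel_ne_zero _)), Equiv.apply_symm_apply,
      Complex.ofReal_one, mul_one] at h
    rw [h]
    exact if_congr (clusterPoint_injective n j).eq_iff.symm rfl rfl
  have hone : inner ℂ (∑ z ∈ cluster (n, j), szegoSimplexKernel.normVec z) (M f) = 1 := by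
    rw [sum_inner, Finset.sum_eq_single_of_mem x hx]
    · rw [ReproducingKernel.inner_normVec_left, hM, hval x hx, if_pos rfl, one_mul,
        norm_kerVec_szegoSimplexKernel, ← ReproducingKernel.inner_normVec_left, hf,
        inner_self_eq_norm_sq_to_K,
        ReproducingKernel.norm_normVec _ (kerVec_szegoKernel_ne_zero x)]
      simp
    · intro z hz hzx
      rw [ReproducingKernel.inner_normVec_left, hM, hval z hz, if_neg hzx, zero_mul, zero_div]
  have h1 := norm_inner_le_norm (𝕜 := ℂ)
    (∑ z ∈ cluster (n, j), szegoSimplexKernel.normVec z) (M f)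
  have h2 : ‖M f‖ ≤ ‖M‖ := by
    refine (M.le_opNorm f).trans (le_of_eq ?_)
    rw [hf, ReproducingKernel.norm_normVec _ (kerVec_szegoKernel_ne_zero x), mul_one]
  rw [hone, norm_one] at h1
  have h3 : (‖M‖ + 1)⁻¹ * (‖M‖ + 1) = 1 := inv_mul_cancel₀ (by positivity)
  nlinarith [norm_nonneg M, norm_nonneg (M f),
    norm_nonneg (∑ z ∈ cluster (n, j), szegoSimplexKernel.normVec z)]

theorem theorem8 :
    ∃ s l : ReproducingKernel 𝔻,
      (∀ z w : 𝔻, s z w = 1 / (1 - (z : ℂ) * conj (w : ℂ))) ∧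
      (∀ z, l.kerVec z ≠ 0) ∧
      ReproducingKernel.IsNormalizedCompletePickFactor s l ∧
      (∀ n : ℕ, 2 ≤ n → ∃ p : ℕ → 𝔻, Function.Injective p ∧
        s.CarlesonCondition p ∧
        l.NWeaklySeparated n p ∧
        ¬ l.NWeaklySeparated (n + 1) p ∧
        ¬ ReproducingKernel.IsInterpolating s l p) ∧
      ¬ (∀ p : ℕ → 𝔻, Function.Injective p →
        (ReproducingKernel.IsInterpolating s l p ↔
          s.CarlesonCondition p ∧ l.WeaklySeparated p)) := by
  classical
  refine ⟨szegoKernel, szegoSimplexKernel, szegoKernel_apply, kerVec_szegoSimplexKernel_ne_zero,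
    ⟨szegoKernel_isNormalizedCompletePick,
      ReproducingKernel.simplex pairwise_disjoint_cluster, fun _ _ => rfl⟩,
    fun n hn => ?_, fun H => ?_⟩
  · have hn0 : 0 < n := by omega
    exact ⟨clusterSeq n, clusterSeq_injective n, szegoKernel_carlesonCondition_clusterSeq n,
      nWeaklySeparated_clusterSeq hn0, not_nWeaklySeparated_succ_clusterSeq hn0,
      not_isInterpolating_clusterSeq hn0⟩
  · exact not_isInterpolating_clusterSeq two_pos ((H _ (clusterSeq_injective 2)).2
      ⟨szegoKernel_carlesonCondition_clusterSeq 2,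
        ReproducingKernel.NWeaklySeparated.weaklySeparated _ (clusterSeq_injective 2)
          kerVec_szegoSimplexKernel_ne_zero (nWeaklySeparated_clusterSeq two_pos)⟩)
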